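/- Let $[n]=\{1,\dots,n\}$, and for a sequence $\vec a=(a_1,\dots,a_p)$ of positive integers with sum $k$ and an integer $d\ge p$ define an $(\vec a,d)$-$\Delta$-system to be a collection of sets $\{E_0\}\cup\{E_i^j : 1\le i\le p,\ 1\le j\le b_i\}$, for some positive integers $b_1,\dots,b_p$ with $b_1+\dots+b_p=d$, such that - for some partition $E_0=A_1\cup\dots\cup A_p$ with $|A_i|=a_i$ for all $i$, and for every $i$, the sets $E_0,E_i^1,\dots,E_i^{b_i}$ are distinct and any two of them intersect exactly in $E_0\setminus A_i$; - the sets $E_i^j\setminus E_0$, over all pairs $(i,j)$, are pairwise disjoint. **Theorem 1.6.** Let $k$ and $d$ be positive integers. For every $\delta>0$ there exist $\varepsilon>0$ and $n_0$, depending only on $k$, $d$ and $\delta$, such that the following holds for every $p$ with $2\le p<k$ and $p\le d$, every sequence $\vec a=(a_1,\dots,a_p)$ of positive integers with $\sum_{i=1}^p a_i=k$, and every $n\ge n_0$. Suppose that $\mathcal H$ is a family of $k$-element subsets of $[n]$ such that no subfamily of $\mathcal H$ is an $(\vec a,d)$-$\Delta$-system and $$|\mathcal H|\ \ge\ (1-\varepsilon)\binom{n-1}{k-1}.$$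 Then there is a vertex $v\in[n]$ that is contained in all but at most $\delta n^{k-1}$ of the sets in $\mathcal H$. -/

import Mathlib

namespace DeltaSys

variable {V : Type*} [DecidableEq V]

/-- `D 0, …, D (s - 1)` are `s ≥ 2` distinct sets forming a Δ-system (sunflower) with center `C`:
any two of them meet exactly in `C`. -/
def IsDeltaSystem {s : ℕ} (D : Fin s → Finset V) (C : Finset V) : Prop :=
  2 ≤ s ∧ Function.Injective D ∧ ∀ i j, i ≠ j → D i ∩ D j = C

/-- `A 0, …, A (p - 1)` is an `a`-partition of `E`: a partition of `E` with `|A i| = a i`. -/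
structure IsVecPartition {p : ℕ} (a : Fin p → ℕ) (E : Finset V) (A : Fin p → Finset V) :
    Prop where
  card_eq : ∀ i, (A i).card = a i
  disjoint : ∀ i j, i ≠ j → Disjoint (A i) (A j)
  union_eq : Finset.univ.biUnion A = E

/-- The sets `E₀` (the host) and `E i j` (`i < p`, `j < b i`) form a semi-`(a, b)`-Δ-system:
for some `a`-partition `A` of `E₀`, for every `i` the family
`E₀, E i 0, …, E i (b i - 1)` is a Δ-system with center `E₀ \ A i`. -/
def IsSemiVecDeltaSystem {p : ℕ} (a b : Fin p → ℕ) (E₀ : Finset V)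
    (E : (i : Fin p) → Fin (b i) → Finset V) : Prop :=
  ∃ A : Fin p → Finset V, IsVecPartition a E₀ A ∧
    ∀ i, IsDeltaSystem (Fin.cons E₀ (E i) : Fin (b i + 1) → Finset V) (E₀ \ A i)

/-- The sets `E₀` and `E i j` form an `(a, b)`-Δ-system: a semi-`(a, b)`-Δ-system in which the
sets `E i j \ E₀`, over all pairs `(i, j)`, are pairwise disjoint. -/
def IsVecDeltaSystem {p : ℕ} (a b : Fin p → ℕ) (E₀ : Finset V)
    (E : (i : Fin p) → Fin (b i) → Finset V) : Prop :=
  IsSemiVecDeltaSystem a b E₀ E ∧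
    ∀ x y : (i : Fin p) × Fin (b i), x ≠ y →
      Disjoint (E x.1 x.2 \ E₀) (E y.1 y.2 \ E₀)

/-- The collection `F` is an `(a, d)`-Δ-system: an `(a, b)`-Δ-system for some sequence `b` of
positive integers with sum `d`. -/
def IsVecNatDeltaSystem {p : ℕ} (a : Fin p → ℕ) (d : ℕ) (F : Finset (Finset V)) : Prop :=
  ∃ b : Fin p → ℕ, (∀ i, 0 < b i) ∧ ∑ i, b i = d ∧
    ∃ (E₀ : Finset V) (E : (i : Fin p) → Fin (b i) → Finset V),
      IsVecDeltaSystem a b E₀ E ∧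
        F = insert E₀
          (Finset.univ.image fun x : (i : Fin p) × Fin (b i) => E x.1 x.2)

end DeltaSys

open Finset
open scoped FinsetFamily

namespace DeltaSys

/-! ### Kernels, blockers and typical sets -/

section Kernel

variable {V : Type*} [DecidableEq V]

/-! A kernel `C` inside a host `E` is the trace on `E` of members of `H` that avoid any prescribed
small set outside `E`, so kernels supply the petals of a Δ-system greedily. All but `O(n^(k-2))`
members of `H` are typical. In a typical `E`, kernels are closed under intersection, and `E \ A` is
a kernel unless `A` contains exactly one free vertex (`IsTypical.isKernel_sdiff`).

If a part of a partition of `E` has a single free vertex `x`, a petal is still available after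
exchanging `x` for some `u` with the resulting set typical; that petal may have to use `u`. Distinct
choices of `u` for the different parts would produce a Δ-system, so Hall's condition fails
(`exists_hall_violator`). Give `E` the weight `∑ 1 / deg (E \ {x})` over free `x`, the degree
counting typical sets. A Hall violator makes this at least `1`, while double counting bounds the
total by `n.choose (k - 1)`. Since `p < k`, some part has size at least `2`; putting two free
vertices into it raises the weight to `1 + 1/s`. As `H` is nearly extremal, almost all members
therefore have exactly one free vertex.

For these, delete the free vertex `v` and group the resulting `(k-1)`-sets by `v`. Groups for
different `v` have disjoint shadows (`freeVert_eq_of_card_inter`), so the shadow sizes sum to at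
most `n.choose (k - 2)`. By Kruskal–Katona in Lovász's form, many small groups would need too much
shadow; hence one group has nearly `n.choose (k - 1)` members, and its `v` is the required vertex.
-/

/-- `C` is an `s`-kernel of `H`: no set of at most `s` vertices meets all the sets `E \ C`,
`C ⊆ E ∈ H`. -/
def IsKernel (H : Finset (Finset V)) (s : ℕ) (C : Finset V) : Prop :=
  ∀ Z : Finset V, Z.card ≤ s → ∃ E ∈ H, C ⊆ E ∧ Disjoint (E \ C) Z

open Classical in
/-- A set of at most `s` vertices witnessing that `C` is not an `s`-kernel of `H`. -/
noncomputable def blocker (H : Finset (Finset V)) (s : ℕ) (C : Finset V) : Finset V :=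
  if h : ∃ Z : Finset V, Z.card ≤ s ∧ ∀ E ∈ H, C ⊆ E → ¬ Disjoint (E \ C) Z then h.choose else ∅

lemma card_blocker_le (H : Finset (Finset V)) (s : ℕ) (C : Finset V) :
    (blocker H s C).card ≤ s := by
  unfold blocker
  split_ifs with h
  · exact h.choose_spec.1
  · simp

lemma not_disjoint_blocker {H : Finset (Finset V)} {s : ℕ} {C E : Finset V}
    (hC : ¬ IsKernel H s C) (hE : E ∈ H) (hCE : C ⊆ E) :
    ¬ Disjoint (E \ C) (blocker H s C) := by
  have h : ∃ Z : Finset V, Z.card ≤ s ∧ ∀ E ∈ H, C ⊆ E → ¬ Disjoint (E \ C) Z := by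
    unfold IsKernel at hC
    push Not at hC
    exact hC
  unfold blocker
  rw [dif_pos h]
  exact h.choose_spec.2 E hE hCE

lemma exists_mem_blocker {H : Finset (Finset V)} {s : ℕ} {C E : Finset V}
    (hC : ¬ IsKernel H s C) (hE : E ∈ H) (hCE : C ⊆ E) :
    ∃ x ∈ E, x ∉ C ∧ x ∈ blocker H s C := by
  have := not_disjoint_blocker hC hE hCE
  rw [Finset.not_disjoint_iff] at this
  obtain ⟨x, hx, hxb⟩ := this
  rw [mem_sdiff] at hx
  exact ⟨x, hx.1, hx.2, hxb⟩

lemma isKernel_self {H : Finset (Finset V)} {s : ℕ} {E : Finset V} (hE : E ∈ H) :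
    IsKernel H s E := fun Z _ => ⟨E, hE, Subset.rfl, by simp⟩

/-- Sets for which the kernels they contain form a rich intersection-closed family. -/
def IsTypical (H : Finset (Finset V)) (s : ℕ) (E : Finset V) : Prop :=
  (∀ u ∈ E, ∀ v ∈ E, u ≠ v → ∀ D ⊆ E \ {u, v},
    ¬ (u ∈ blocker H s D ∧ v ∈ blocker H s D)) ∧
  ∀ x ∈ E, ∀ y ∈ E, x ≠ y → x ∈ blocker H s (E \ {x, y}) → IsKernel H s (E.erase y)

open Classical in
/-- The typical members of `H`. -/
noncomputable def typicalPart (H : Finset (Finset V)) (s : ℕ) : Finset (Finset V) :=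
  H.filter (IsTypical H s)

open Classical in
/-- The vertices `x` of `E` such that `E \ {x}` is not a kernel. -/
noncomputable def freeVerts (H : Finset (Finset V)) (s : ℕ) (E : Finset V) : Finset V :=
  E.filter fun x => ¬ IsKernel H s (E.erase x)

lemma mem_freeVerts {H : Finset (Finset V)} {s : ℕ} {E : Finset V} {x : V} :
    x ∈ freeVerts H s E ↔ x ∈ E ∧ ¬ IsKernel H s (E.erase x) := by
  simp [freeVerts]

lemma freeVerts_subset (H : Finset (Finset V)) (s : ℕ) (E : Finset V) :
    freeVerts H s E ⊆ E := fun _ hx => (mem_freeVerts.1 hx).1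

lemma mem_typicalPart {H : Finset (Finset V)} {s : ℕ} {E : Finset V} :
    E ∈ typicalPart H s ↔ E ∈ H ∧ IsTypical H s E := by
  simp [typicalPart]

lemma typicalPart_subset (H : Finset (Finset V)) (s : ℕ) : typicalPart H s ⊆ H :=
  fun _ hE => (mem_typicalPart.1 hE).1

/-- Suppose the intersection is blocked. A member of `H` through `C₁` avoiding the blocker outside
`C₁` must still hit it, hence in `C₁ \ C₂`; similarly for `C₂`. Two blocker vertices in `E`
contradict the first typicality condition. -/
lemma IsTypical.isKernel_inter {H : Finset (Finset V)} {s : ℕ} {E C₁ C₂ : Finset V}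
    (hE : IsTypical H s E) (h₁ : IsKernel H s C₁) (h₂ : IsKernel H s C₂)
    (hC₁ : C₁ ⊆ E) (hC₂ : C₂ ⊆ E) : IsKernel H s (C₁ ∩ C₂) := by
  by_contra hD
  have key : ∀ C, C₁ ∩ C₂ ⊆ C → IsKernel H s C →
      ∃ x ∈ C, x ∉ C₁ ∩ C₂ ∧ x ∈ blocker H s (C₁ ∩ C₂) := by
    intro C hsub hC
    obtain ⟨F, hF, hCF, hdis⟩ := hC _ (card_blocker_le H s (C₁ ∩ C₂))
    obtain ⟨x, hxF, hxD, hxb⟩ := exists_mem_blocker hD hF (hsub.trans hCF)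
    refine ⟨x, ?_, hxD, hxb⟩
    by_contra hxC
    exact (Finset.disjoint_left.1 hdis (mem_sdiff.2 ⟨hxF, hxC⟩)) hxb
  obtain ⟨u, hu, huD, hub⟩ := key C₁ inter_subset_left h₁
  obtain ⟨v, hv, hvD, hvb⟩ := key C₂ inter_subset_right h₂
  have huv : u ≠ v := by
    rintro rfl
    exact huD (mem_inter.2 ⟨hu, hv⟩)
  refine hE.1 u (hC₁ hu) v (hC₂ hv) huv (C₁ ∩ C₂) ?_ ⟨hub, hvb⟩
  intro z hz
  rw [mem_sdiff]
  refine ⟨hC₁ (mem_inter.1 hz).1, ?_⟩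
  simp only [mem_insert, mem_singleton]
  rintro (rfl | rfl)
  · exact huD hz
  · exact hvD hz

/-- `E \ A` is the intersection of the kernels `E \ B` as the sets `B` cover `A`. -/
lemma IsTypical.isKernel_sdiff_of_forall {H : Finset (Finset V)} {s : ℕ} {E A : Finset V}
    (hE : IsTypical H s E) (hEH : E ∈ H)
    (h : ∀ z ∈ A, ∃ B, z ∈ B ∧ B ⊆ A ∧ IsKernel H s (E \ B)) : IsKernel H s (E \ A) := by
  have key : ∀ A' : Finset V, A' ⊆ A → ∃ B, A' ⊆ B ∧ B ⊆ A ∧ IsKernel H s (E \ B) := by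
    intro A'
    induction A' using Finset.induction_on with
    | empty =>
      intro _
      exact ⟨∅, Subset.rfl, by simp, by simpa using isKernel_self hEH⟩
    | insert z A' hz ih =>
      intro hsub
      obtain ⟨B, hAB, hBA, hB⟩ := ih ((subset_insert _ _).trans hsub)
      obtain ⟨B', hzB', hBA', hB'⟩ := h z (hsub (mem_insert_self _ _))
      refine ⟨B ∪ B', ?_, union_subset hBA hBA', ?_⟩
      · exact insert_subset (mem_union_right _ hzB') (hAB.trans subset_union_left)
      · have : E \ (B ∪ B') = (E \ B) ∩ (E \ B') := by
          ext; simp; tauto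
        rw [this]
        exact hE.isKernel_inter hB hB' sdiff_subset sdiff_subset
  obtain ⟨B, hAB, hBA, hB⟩ := key A Subset.rfl
  rwa [Subset.antisymm hBA hAB] at hB

/-- A blocker of `E \ {x, y}` would have to meet `E` in `x` or `y`; the second typicality condition
then contradicts the freeness of the other vertex. -/
lemma IsTypical.isKernel_sdiff_pair {H : Finset (Finset V)} {s : ℕ} {E : Finset V} {x y : V}
    (hE : IsTypical H s E) (hEH : E ∈ H) (hx : x ∈ freeVerts H s E) (hy : y ∈ freeVerts H s E)
    (hxy : x ≠ y) : IsKernel H s (E \ {x, y}) := by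
  by_contra hD
  rw [mem_freeVerts] at hx hy
  obtain ⟨z, hzE, hz, hzb⟩ := exists_mem_blocker hD hEH sdiff_subset
  have hz' : z = x ∨ z = y := by
    by_contra hne
    apply hz
    simp only [mem_sdiff, mem_insert, mem_singleton]
    exact ⟨hzE, hne⟩
  rcases hz' with rfl | rfl
  · exact hy.2 (hE.2 z hx.1 y hy.1 hxy hzb)
  · rw [pair_comm] at hzb
    exact hx.2 (hE.2 z hy.1 x hx.1 hxy.symm hzb)

/-- Cover `A` by singletons of non-free vertices and pairs of free ones; only a lone free vertex
cannot be covered. -/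
lemma IsTypical.isKernel_sdiff {H : Finset (Finset V)} {s : ℕ} {E A : Finset V}
    (hE : IsTypical H s E) (hEH : E ∈ H) (hA : A ⊆ E) (hcard : (A ∩ freeVerts H s E).card ≠ 1) :
    IsKernel H s (E \ A) := by
  apply hE.isKernel_sdiff_of_forall hEH
  intro z hz
  by_cases hzN : z ∈ freeVerts H s E
  · have h1 : 1 < (A ∩ freeVerts H s E).card := by
      have : 0 < (A ∩ freeVerts H s E).card := card_pos.2 ⟨z, mem_inter.2 ⟨hz, hzN⟩⟩
      omega
    obtain ⟨w, hw, hwz⟩ := exists_mem_ne h1 z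
    rw [mem_inter] at hw
    refine ⟨{z, w}, by simp, ?_, hE.isKernel_sdiff_pair hEH hzN hw.2 hwz.symm⟩
    intro t ht
    simp only [mem_insert, mem_singleton] at ht
    rcases ht with rfl | rfl
    · exact hz
    · exact hw.1
  · refine ⟨{z}, by simp, by simpa using hz, ?_⟩
    rw [mem_freeVerts] at hzN
    rw [sdiff_singleton_eq_erase]
    by_contra hk
    exact hzN ⟨hA hz, hk⟩

/-- The sets of `H` that are not typical are few. -/
lemma card_filter_not_isTypical_le [Fintype V] {H : Finset (Finset V)} {k : ℕ} (s : ℕ)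
    (hk : ∀ E ∈ H, E.card = k) :
    (H \ typicalPart H s).card ≤ (Fintype.card V).choose (k - 2) * (2 ^ (k - 2) * s ^ 2 + s ^ 2)
    := by
  -- An atypical `E` is `R` plus a bad pair. Either both vertices lie in the blocker of some `D ⊆
  -- R`, or `x` is in the blocker of `R` and `y` in that of `insert x R`; so each `R` allows
  -- boundedly many `E`.
  have hsub : H \ typicalPart H s ⊆ (powersetCard (k - 2) (univ : Finset V)).biUnion fun R =>
      (R.powerset.biUnion fun D => (blocker H s D ×ˢ blocker H s D).image
        fun q => insert q.1 (insert q.2 R)) ∪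
      ((blocker H s R).biUnion fun x => (blocker H s (insert x R)).image
        fun y => insert x (insert y R)) := by
    intro E hE
    rw [mem_sdiff, mem_typicalPart] at hE
    obtain ⟨hEH, hnot⟩ := hE
    have hnt : ¬ IsTypical H s E := fun h => hnot ⟨hEH, h⟩
    have hpair : ∀ u ∈ E, ∀ v ∈ E, u ≠ v → (E \ {u, v}) ∈ powersetCard (k - 2) (univ : Finset V) ∧
        insert u (insert v (E \ {u, v})) = E := by
      intro u hu v hv huv
      have hs : ({u, v} : Finset V) ⊆ E := by
        intro t ht
        simp only [mem_insert, mem_singleton] at ht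
        rcases ht with rfl | rfl <;> assumption
      constructor
      · rw [mem_powersetCard]
        refine ⟨subset_univ _, ?_⟩
        rw [card_sdiff_of_subset hs, card_pair huv, hk E hEH]
      · ext t
        simp only [mem_insert, mem_sdiff, mem_singleton]
        constructor
        · rintro (rfl | rfl | h)
          · exact hu
          · exact hv
          · exact h.1
        · intro ht
          tauto
    rw [mem_biUnion]
    unfold IsTypical at hnt
    rw [not_and_or] at hnt
    rcases hnt with hnt | hnt
    · push Not at hnt
      obtain ⟨u, hu, v, hv, huv, D, hD, hub, hvb⟩ := hnt
      refine ⟨E \ {u, v}, (hpair u hu v hv huv).1, mem_union_left _ ?_⟩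
      rw [mem_biUnion]
      refine ⟨D, mem_powerset.2 hD, mem_image.2 ⟨(u, v), ?_, (hpair u hu v hv huv).2⟩⟩
      exact mem_product.2 ⟨hub, hvb⟩
    · push Not at hnt
      obtain ⟨x, hx, y, hy, hxy, hxb, hyk⟩ := hnt
      refine ⟨E \ {x, y}, (hpair x hx y hy hxy).1, mem_union_right _ ?_⟩
      rw [mem_biUnion]
      refine ⟨x, hxb, mem_image.2 ⟨y, ?_, (hpair x hx y hy hxy).2⟩⟩
      have he : insert x (E \ {x, y}) = E.erase y := by
        ext t
        simp only [mem_insert, mem_sdiff, mem_singleton, mem_erase]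
        constructor
        · rintro (rfl | h)
          · exact ⟨hxy, hx⟩
          · tauto
        · intro h
          tauto
      rw [he]
      obtain ⟨z, hzE, hz, hzb⟩ := exists_mem_blocker hyk hEH (erase_subset _ _)
      have : z = y := by
        by_contra hne
        exact hz (mem_erase.2 ⟨hne, hzE⟩)
      exact this ▸ hzb
  refine (card_le_card hsub).trans ?_
  refine (card_biUnion_le_card_mul _ _ (2 ^ (k - 2) * s ^ 2 + s ^ 2) ?_).trans ?_
  · intro R hR
    rw [mem_powersetCard] at hR
    refine (card_union_le _ _).trans (add_le_add ?_ ?_)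
    · refine (card_biUnion_le_card_mul _ _ (s ^ 2) ?_).trans ?_
      · intro D _
        refine card_image_le.trans ?_
        rw [card_product, sq]
        exact Nat.mul_le_mul (card_blocker_le _ _ _) (card_blocker_le _ _ _)
      · rw [card_powerset, hR.2]
    · refine (card_biUnion_le_card_mul _ _ s ?_).trans ?_
      · intro x _
        exact card_image_le.trans (card_blocker_le _ _ _)
      · rw [sq]
        exact Nat.mul_le_mul_right _ (card_blocker_le _ _ _)
  · rw [card_powersetCard, card_univ]

/-- Given a typical neighbour of `E` missing the free vertex `x`, every `E \ A` with `x ∈ A` is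
an intersection of `E` with a member of `H`. -/
lemma IsTypical.exists_inter_eq_sdiff {H : Finset (Finset V)} {k s : ℕ}
    (hk : ∀ E ∈ H, E.card = k) {E A : Finset V} {x u : V} (hEH : E ∈ H)
    (hx : x ∈ freeVerts H s E) (hu : u ∉ E)
    (hE' : insert u (E.erase x) ∈ typicalPart H s) (hxA : x ∈ A) (hA : A ⊆ E) {Z : Finset V}
    (hZ : Z.card + k ≤ s) :
    ∃ F ∈ H, F ∩ E = E \ A ∧ (F \ E) ∩ Z ⊆ {u} := by
  rw [mem_typicalPart] at hE'
  obtain ⟨hE'H, hE'⟩ := hE'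
  rw [mem_freeVerts] at hx
  set E' := insert u (E.erase x) with hE'def
  have huE' : u ∈ E' := mem_insert_self _ _
  have hux : u ≠ x := fun h => hu (h ▸ hx.1)
  have huN : u ∈ freeVerts H s E' := by
    rw [mem_freeVerts]
    refine ⟨huE', ?_⟩
    rw [hE'def, erase_insert (fun h => hu (mem_of_mem_erase h))]
    exact hx.2
  have hcard : (Z ∪ E).card ≤ s := (card_union_le _ _).trans (by rw [hk E hEH]; exact hZ)
  -- If `A \ {x}` contains a free vertex of `E'`, removing `u` with it deletes two free vertices and
  -- `E \ A` itself is a kernel. Otherwise only `(E \ A) ∪ {u}` is known to be a kernel, so `F`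
  -- contains `u`: this is why `u` is exempt from avoiding `Z`.
  by_cases hB : (A.erase x ∩ freeVerts H s E').Nonempty
  · obtain ⟨y, hy⟩ := hB
    rw [mem_inter, mem_erase] at hy
    have hker : IsKernel H s (E' \ insert u (A.erase x)) := by
      apply hE'.isKernel_sdiff hE'H
      · refine insert_subset huE' fun t ht => ?_
        rw [mem_erase] at ht
        exact mem_insert_of_mem (mem_erase.2 ⟨ht.1, hA ht.2⟩)
      · have : 1 < (insert u (A.erase x) ∩ freeVerts H s E').card := by
          rw [one_lt_card]
          refine ⟨u, mem_inter.2 ⟨mem_insert_self _ _, huN⟩, y,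
            mem_inter.2 ⟨mem_insert_of_mem (mem_erase.2 hy.1), hy.2⟩, ?_⟩
          rintro rfl
          exact hu (hA hy.1.2)
        omega
    have heq : E' \ insert u (A.erase x) = E \ A := by
      ext t
      simp only [hE'def, mem_sdiff, mem_insert, mem_erase]
      constructor
      · rintro ⟨h1 | h1, h2⟩
        · tauto
        · tauto
      · rintro ⟨h1, h2⟩
        have : t ≠ x := fun h => h2 (h ▸ hxA)
        have : t ≠ u := fun h => hu (h ▸ h1)
        tauto
    rw [heq] at hker
    obtain ⟨F, hF, hsub, hdis⟩ := hker _ hcard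
    rw [disjoint_left] at hdis
    refine ⟨F, hF, ?_, ?_⟩
    · ext t
      have h1 := @hdis t
      have h2 := @hsub t
      simp only [mem_sdiff, mem_inter, mem_union] at *
      tauto
    · intro t ht
      have h1 := @hdis t
      simp only [mem_sdiff, mem_inter, mem_union] at *
      tauto
  · rw [not_nonempty_iff_eq_empty] at hB
    have hker : IsKernel H s (E' \ A.erase x) := by
      apply hE'.isKernel_sdiff hE'H
      · intro t ht
        rw [mem_erase] at ht
        exact mem_insert_of_mem (mem_erase.2 ⟨ht.1, hA ht.2⟩)
      · rw [hB]; simp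
    obtain ⟨F, hF, hsub, hdis⟩ := hker _ hcard
    rw [disjoint_left] at hdis
    have hiff : ∀ t, t ∈ E' \ A.erase x ↔ t = u ∨ (t ∈ E ∧ t ∉ A) := by
      intro t
      simp only [hE'def, mem_sdiff, mem_insert, mem_erase]
      constructor
      · tauto
      · rintro (rfl | ⟨h1, h2⟩)
        · exact ⟨Or.inl rfl, fun h => hu (hA h.2)⟩
        · have : t ≠ x := fun h => h2 (h ▸ hxA)
          tauto
    refine ⟨F, hF, ?_, ?_⟩
    · ext t
      have h1 := @hdis t
      have h2 := @hsub t
      rw [mem_sdiff, hiff] at h1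
      rw [hiff] at h2
      have h3 : t = u → t ∉ E := fun h => h ▸ hu
      simp only [mem_sdiff, mem_inter, mem_union] at *
      tauto
    · intro t ht
      have h1 := @hdis t
      rw [mem_sdiff, hiff] at h1
      simp only [mem_sdiff, mem_inter, mem_union, mem_singleton] at *
      tauto

/-- Avoid `Z ∪ E` outside `C`; the bound on `Z` leaves room for the `k` vertices of `E`. -/
lemma IsKernel.exists_inter_eq {H : Finset (Finset V)} {k s : ℕ}
    (hk : ∀ E ∈ H, E.card = k) {E C : Finset V} (hEH : E ∈ H) (hC : IsKernel H s C) (hCE : C ⊆ E)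
    {Z : Finset V} (hZ : Z.card + k ≤ s) :
    ∃ F ∈ H, F ∩ E = C ∧ (F \ E) ∩ Z = ∅ := by
  have hcard : (Z ∪ E).card ≤ s := (card_union_le _ _).trans (by rw [hk E hEH]; exact hZ)
  obtain ⟨F, hF, hsub, hdis⟩ := hC _ hcard
  rw [disjoint_left] at hdis
  refine ⟨F, hF, ?_, ?_⟩
  · ext t
    have h1 := @hdis t
    have h2 := @hsub t
    have h3 := @hCE t
    simp only [mem_sdiff, mem_inter, mem_union] at *
    tauto
  · rw [eq_empty_iff_forall_notMem]
    intro t ht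
    have h1 := @hdis t
    have h2 := @hCE t
    simp only [mem_sdiff, mem_inter, mem_union] at *
    tauto

end Kernel

/-! ### Greedy construction of Δ-systems -/

section Build

variable {V : Type*} [DecidableEq V]

/-- Greedy choice of pairwise disjoint sets `F i` with property `Q i`, when each `F i` can be chosen
to meet any prescribed small set only inside `P i`. -/
lemma exists_pairwise_disjoint {ι : Type*} [Fintype ι] [DecidableEq ι] (P : ι → Finset V)
    (hP : ∀ i j, i ≠ j → Disjoint (P i) (P j)) (Q : ι → Finset V → Prop) (k : ℕ)
    (hPk : ∀ i, (P i).card ≤ k)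
    (h : ∀ i, ∀ Z : Finset V, Z.card ≤ 2 * Fintype.card ι * k →
      ∃ F, Q i F ∧ F.card ≤ k ∧ F ∩ Z ⊆ P i) :
    ∃ F : ι → Finset V, (∀ i, Q i (F i)) ∧ ∀ i j, i ≠ j → Disjoint (F i) (F j) := by
  set U := (univ : Finset ι).biUnion P with hU
  have hUcard : U.card ≤ Fintype.card ι * k := by
    refine (card_biUnion_le_card_mul _ _ k fun i _ => hPk i).trans ?_
    rw [card_univ]
  have hPU : ∀ i, P i ⊆ U := fun i => subset_biUnion_of_mem P (mem_univ i)
  have key : ∀ t : Finset ι, ∃ F : ι → Finset V,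
      (∀ i ∈ t, Q i (F i) ∧ (F i).card ≤ k ∧ F i ∩ U ⊆ P i) ∧
      ∀ i ∈ t, ∀ j ∈ t, i ≠ j → Disjoint (F i) (F j) := by
    intro t
    induction t using Finset.induction_on with
    | empty => exact ⟨fun _ => ∅, by simp, by simp⟩
    | insert a t ha ih =>
      obtain ⟨F, hF, hdis⟩ := ih
      -- The factor `2`: one share for all reserved sets, one for the sets already chosen.
      have hcard : (U ∪ t.biUnion F).card ≤ 2 * Fintype.card ι * k := by
        have h1 : (t.biUnion F).card ≤ t.card * k :=
          card_biUnion_le_card_mul _ _ k fun i hi => (hF i hi).2.1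
        have h2 : t.card * k ≤ Fintype.card ι * k := Nat.mul_le_mul_right _ (card_le_univ t)
        have h3 := card_union_le U (t.biUnion F)
        nlinarith
      obtain ⟨G, hQ, hGk, hG⟩ := h a _ hcard
      have hGdis : ∀ i ∈ t, Disjoint G (F i) := by
        intro i hi
        rw [disjoint_left]
        intro w hwG hwF
        -- A common vertex would lie in `P a`, hence in `U`, hence also in `P i` by the invariant,
        -- against disjointness of the reserved sets.
        have hw : w ∈ P a :=
          hG (mem_inter.2 ⟨hwG, mem_union_right _ (mem_biUnion.2 ⟨i, hi, hwF⟩)⟩)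
        have hw' : w ∈ P i := (hF i hi).2.2 (mem_inter.2 ⟨hwF, hPU a hw⟩)
        have hia : a ≠ i := fun h => ha (h ▸ hi)
        exact disjoint_left.1 (hP a i hia) hw hw'
      have hne : ∀ i ∈ t, i ≠ a := fun i hi h => ha (h ▸ hi)
      refine ⟨Function.update F a G, ?_, ?_⟩
      · intro i hi
        rw [mem_insert] at hi
        rcases hi with rfl | hi
        · rw [Function.update_self]
          exact ⟨hQ, hGk, fun w hw => hG (inter_subset_inter_left subset_union_left hw)⟩
        · rw [Function.update_of_ne (hne i hi)]
          exact hF i hi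
      · intro i hi j hj hij
        rw [mem_insert] at hi hj
        rcases hi with rfl | hi
        · rcases hj with rfl | hj
          · exact absurd rfl hij
          · rw [Function.update_self, Function.update_of_ne (hne j hj)]
            exact hGdis j hj
        · rcases hj with rfl | hj
          · rw [Function.update_self, Function.update_of_ne (hne i hi)]
            exact (hGdis i hi).symm
          · rw [Function.update_of_ne (hne i hi), Function.update_of_ne (hne j hj)]
            exact hdis i hi j hj hij
  obtain ⟨F, hF, hdis⟩ := key univ
  exact ⟨F, fun i => (hF i (mem_univ i)).1, fun i j => hdis i (mem_univ i) j (mem_univ j)⟩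

/-- A host set `E` with a partition `A` such that each `E \ A i` is the trace of members of `H`
which, outside `E`, meet prescribed small sets only inside `P i`. -/
theorem exists_vecNatDeltaSystem {H : Finset (Finset V)} {k d p : ℕ}
    (hk : ∀ E ∈ H, E.card = k) {a : Fin p → ℕ} (hpd : p ≤ d) (ha : ∀ i, 0 < a i)
    {E : Finset V} (hEH : E ∈ H) {A : Fin p → Finset V} (hA : IsVecPartition a E A)
    (P : Fin p → Finset V) (hP : ∀ i j, i ≠ j → Disjoint (P i) (P j))
    (hPk : ∀ i, (P i).card ≤ k) (i₀ : Fin p) (hi₀ : P i₀ = ∅)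
    (h : ∀ i, ∀ Z : Finset V, Z.card ≤ 2 * d * k →
      ∃ F ∈ H, F ∩ E = E \ A i ∧ (F \ E) ∩ Z ⊆ P i) :
    ∃ F : Finset (Finset V), F ⊆ H ∧ IsVecNatDeltaSystem a d F := by
  -- A nonempty reserved set can serve only one petal, so all surplus petals go to `i₀`, where
  -- nothing is reserved.
  set b : Fin p → ℕ := fun i => if i = i₀ then d - p + 1 else 1 with hb
  have hbpos : ∀ i, 0 < b i := by
    intro i; simp only [hb]; split_ifs <;> omega
  have hbsum : ∑ i, b i = d := by
    have h1 : ∀ i, b i = (if i = i₀ then d - p else 0) + 1 := by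
      intro i; simp only [hb]; split_ifs <;> omega
    rw [sum_congr rfl fun i _ => h1 i, sum_add_distrib]
    simp
    omega
  have hcard : Fintype.card ((i : Fin p) × Fin (b i)) = d := by
    rw [Fintype.card_sigma]; simp [hbsum]
  obtain ⟨G, hG, hGdis⟩ := exists_pairwise_disjoint
    (ι := (i : Fin p) × Fin (b i)) (fun x => P x.1) (by
      intro x y hxy
      by_cases h1 : x.1 = y.1
      · by_cases h2 : x.1 = i₀
        · simp [h2, hi₀]
        · exfalso
          apply hxy
          obtain ⟨i, j⟩ := x
          obtain ⟨i', j'⟩ := y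
          obtain rfl : i = i' := h1
          have hbi : b i = 1 := by simp only [hb]; rw [if_neg h2]
          congr 1
          apply Fin.ext
          have := j.2
          have := j'.2
          omega
      · exact hP _ _ h1)
    (fun x S => ∃ F ∈ H, F ∩ E = E \ A x.1 ∧ S = F \ E) k (fun x => hPk x.1) (by
      intro x Z hZ
      rw [hcard] at hZ
      obtain ⟨F, hF, h1, h2⟩ := h x.1 Z hZ
      exact ⟨F \ E, ⟨F, hF, h1, rfl⟩, (card_le_card sdiff_subset).trans (hk F hF).le, h2⟩)
  choose D hDH hDE hGD using hG
  have hAE : ∀ i, A i ⊆ E := fun i => by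
    rw [← hA.union_eq]; exact subset_biUnion_of_mem A (mem_univ i)
  have hAne : ∀ i, (A i).Nonempty := fun i => by
    rw [← card_pos, hA.card_eq]; exact ha i
  have hDdis : ∀ x y, x ≠ y → Disjoint (D x \ E) (D y \ E) := by
    intro x y hxy
    have := hGdis x y hxy
    rwa [hGD, hGD] at this
  have hDne : ∀ x, D x ≠ E := by
    intro x hx
    have := hDE x
    rw [hx, inter_self] at this
    obtain ⟨w, hw⟩ := hAne x.1
    have hwE := hAE _ hw
    rw [this, mem_sdiff] at hwE
    exact hwE.2 hw
  have hDinter : ∀ (i : Fin p) (j j' : Fin (b i)), j ≠ j' → D ⟨i, j⟩ ∩ D ⟨i, j'⟩ = E \ A i := by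
    intro i j j' hjj'
    have hxy : (⟨i, j⟩ : (i : Fin p) × Fin (b i)) ≠ ⟨i, j'⟩ := by
      intro h
      exact hjj' (by simpa using h)
    have h1 := disjoint_left.1 (hDdis _ _ hxy)
    have h2 := Finset.ext_iff.1 (hDE ⟨i, j⟩)
    have h3 := Finset.ext_iff.1 (hDE ⟨i, j'⟩)
    ext w
    have h1 := @h1 w
    have h2 := h2 w
    have h3 := h3 w
    simp only [mem_inter, mem_sdiff] at *
    tauto
  have hDnesub : ∀ x, ¬ D x ⊆ E := by
    intro x hx
    exact hDne x (eq_of_subset_of_card_le hx (by rw [hk _ hEH, hk _ (hDH x)]))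
  have hDinj : ∀ (i : Fin p), Function.Injective fun j => D ⟨i, j⟩ := by
    intro i j j' heq
    by_contra hjj'
    have h1 := hDinter i j j' hjj'
    have heq' : D ⟨i, j⟩ = D ⟨i, j'⟩ := heq
    rw [← heq', inter_self] at h1
    exact hDnesub ⟨i, j⟩ (h1 ▸ sdiff_subset)
  refine ⟨insert E (univ.image fun x : (i : Fin p) × Fin (b i) => D ⟨x.1, x.2⟩), ?_,
    b, hbpos, hbsum, E, fun i j => D ⟨i, j⟩, ⟨⟨A, hA, ?_⟩, ?_⟩, rfl⟩
  · refine insert_subset hEH ?_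
    intro F hF
    rw [mem_image] at hF
    obtain ⟨x, _, rfl⟩ := hF
    exact hDH _
  · intro i
    refine ⟨by have := hbpos i; omega, ?_, ?_⟩
    · rw [Fin.cons_injective_iff]
      refine ⟨?_, hDinj i⟩
      rintro ⟨j, hj⟩
      exact hDne _ hj
    · intro x y hxy
      induction x using Fin.cases with
      | zero =>
        induction y using Fin.cases with
        | zero => exact absurd rfl hxy
        | succ y =>
          simp only [Fin.cons_zero, Fin.cons_succ]
          rw [inter_comm]
          exact hDE ⟨i, y⟩
      | succ x =>
        induction y using Fin.cases with
        | zero =>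
          simp only [Fin.cons_zero, Fin.cons_succ]
          exact hDE ⟨i, x⟩
        | succ y =>
          simp only [Fin.cons_succ]
          exact hDinter i x y fun h => hxy (h ▸ rfl)
  · intro x y hxy
    exact hDdis x y hxy

/-- A set of size `∑ a i` has an `a`-partition in which a prescribed part contains a prescribed
subset. -/
lemma exists_isVecPartition {p : ℕ} {a : Fin p → ℕ} {E t : Finset V} (i₀ : Fin p)
    (hE : E.card = ∑ i, a i) (htE : t ⊆ E) (ht : t.card ≤ a i₀) :
    ∃ A : Fin p → Finset V, IsVecPartition a E A ∧ t ⊆ A i₀ := by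
  have key : ∀ (I : Finset (Fin p)) (E : Finset V), E.card = ∑ i ∈ I, a i →
      ∃ A : Fin p → Finset V, (∀ i ∈ I, (A i).card = a i) ∧
        (∀ i ∈ I, ∀ j ∈ I, i ≠ j → Disjoint (A i) (A j)) ∧ I.biUnion A = E := by
    intro I
    induction I using Finset.induction_on with
    | empty =>
      intro E hE
      refine ⟨fun _ => ∅, by simp, by simp, ?_⟩
      rw [sum_empty, card_eq_zero] at hE
      simp [hE]
    | insert i I hi ih =>
      intro E hE
      rw [sum_insert hi] at hE
      obtain ⟨S, hSE, hS⟩ := exists_subset_card_eq (show a i ≤ E.card by omega)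
      obtain ⟨A, h1, h2, h3⟩ := ih (E \ S) (by rw [card_sdiff_of_subset hSE]; omega)
      have hne : ∀ j ∈ I, j ≠ i := fun j hj h => hi (h ▸ hj)
      have hsub : ∀ j ∈ I, Disjoint S (A j) := by
        intro j hj
        have : A j ⊆ E \ S := h3 ▸ subset_biUnion_of_mem A hj
        exact disjoint_of_subset_right this disjoint_sdiff
      refine ⟨Function.update A i S, ?_, ?_, ?_⟩
      · intro j hj
        rcases mem_insert.1 hj with rfl | hj
        · rw [Function.update_self, hS]
        · rw [Function.update_of_ne (hne j hj), h1 j hj]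
      · intro j hj l hl hjl
        rcases mem_insert.1 hj with hji | hj <;> rcases mem_insert.1 hl with hli | hl
        · exact absurd (hji.trans hli.symm) hjl
        · rw [hji, Function.update_self, Function.update_of_ne (hne l hl)]
          exact hsub l hl
        · rw [hli, Function.update_self, Function.update_of_ne (hne j hj)]
          exact (hsub j hj).symm
        · rw [Function.update_of_ne (hne l hl), Function.update_of_ne (hne j hj)]
          exact h2 j hj l hl hjl
      · rw [biUnion_insert, Function.update_self,
          biUnion_congr rfl fun j hj => Function.update_of_ne (hne j hj) S A, h3,
          union_sdiff_of_subset hSE]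
  have hsum : a i₀ + ∑ i ∈ univ.erase i₀, a i = ∑ i, a i := add_sum_erase _ _ (mem_univ i₀)
  obtain ⟨S, htS, hSE, hS⟩ := exists_subsuperset_card_eq htE ht (by omega)
  obtain ⟨A, h1, h2, h3⟩ := key (univ.erase i₀) (E \ S)
    (by rw [card_sdiff_of_subset hSE]; omega)
  have hmem : ∀ j, j ≠ i₀ → j ∈ univ.erase i₀ := fun j hj => mem_erase.2 ⟨hj, mem_univ j⟩
  have hsub : ∀ j, j ≠ i₀ → Disjoint S (A j) := by
    intro j hj
    have : A j ⊆ E \ S := h3 ▸ subset_biUnion_of_mem A (hmem j hj)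
    exact disjoint_of_subset_right this disjoint_sdiff
  refine ⟨Function.update A i₀ S, ⟨?_, ?_, ?_⟩, by rwa [Function.update_self]⟩
  · intro j
    by_cases hj : j = i₀
    · rw [hj, Function.update_self, hS]
    · rw [Function.update_of_ne hj, h1 j (hmem j hj)]
  · intro j l hjl
    by_cases hj : j = i₀
    · have hl : l ≠ i₀ := fun h => hjl (hj.trans h.symm)
      rw [hj, Function.update_self, Function.update_of_ne hl]
      exact hsub l hl
    · rw [Function.update_of_ne hj]
      by_cases hl : l = i₀
      · rw [hl, Function.update_self]
        exact (hsub j hj).symm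
      · rw [Function.update_of_ne hl]
        exact h2 j (hmem j hj) l (hmem l hl) hjl
  · have hupd : ∀ j ∈ univ.erase i₀, Function.update A i₀ S j = A j := fun j hj =>
      Function.update_of_ne (mem_erase.1 hj).1 S A
    rw [← insert_erase (mem_univ i₀), biUnion_insert, Function.update_self,
      biUnion_congr rfl hupd, h3, union_sdiff_of_subset hSE]

end Build

/-! ### Exchange sets, Hall violators and the weight count -/

section Weight

variable {V : Type*} [DecidableEq V]

lemma eq_insert_of_card {T F : Finset V} {y : V} (hTF : T ⊆ F) (hcard : F.card = T.card + 1)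
    (hyF : y ∈ F) (hyT : y ∉ T) : F = insert y T := by
  symm
  refine eq_of_subset_of_card_le (insert_subset hyF hTF) ?_
  rw [card_insert_of_notMem hyT, hcard]

lemma IsVecPartition.subset {p : ℕ} {a : Fin p → ℕ} {E : Finset V} {A : Fin p → Finset V}
    (hA : IsVecPartition a E A) (i : Fin p) : A i ⊆ E := by
  rw [← hA.union_eq]; exact subset_biUnion_of_mem A (mem_univ i)

/-- The number of typical members of `H` that contain `T`. -/
noncomputable def typicalDeg (H : Finset (Finset V)) (s : ℕ) (T : Finset V) : ℕ :=
  ((typicalPart H s).filter fun F => T ⊆ F).card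

variable {H : Finset (Finset V)} {k s d p : ℕ} {a : Fin p → ℕ} {E : Finset V}

/-- The one extra vertex of a member containing `E \ {x}` must lie in the blocker. -/
lemma typicalDeg_le_of_mem_freeVerts (hk : ∀ E ∈ H, E.card = k) (hE : E ∈ typicalPart H s) {x : V}
    (hx : x ∈ freeVerts H s E) : typicalDeg H s (E.erase x) ≤ s := by
  rw [mem_freeVerts] at hx
  have hsub : (typicalPart H s).filter (fun F => E.erase x ⊆ F) ⊆
      (blocker H s (E.erase x)).image fun y => insert y (E.erase x) := by
    intro F hF
    rw [mem_filter] at hF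
    have hFH := typicalPart_subset H s hF.1
    obtain ⟨y, hyF, hyT, hyb⟩ := exists_mem_blocker hx.2 hFH hF.2
    refine mem_image.2 ⟨y, hyb, ?_⟩
    refine (eq_insert_of_card hF.2 ?_ hyF hyT).symm
    rw [card_erase_add_one hx.1, hk E (typicalPart_subset H s hE), hk F hFH]
  exact (card_le_card hsub).trans (card_image_le.trans (card_blocker_le _ _ _))

lemma typicalDeg_erase_pos (hE : E ∈ typicalPart H s) (x : V) :
    0 < typicalDeg H s (E.erase x) :=
  card_pos.2 ⟨E, mem_filter.2 ⟨hE, erase_subset _ _⟩⟩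

variable [Fintype V]

/-- The vertices `u ∉ E` such that exchanging `x` for `u` turns `E` into a typical set. -/
noncomputable def exchange (H : Finset (Finset V)) (s : ℕ) (E : Finset V) (x : V) : Finset V :=
  univ.filter fun u => u ∉ E ∧ insert u (E.erase x) ∈ typicalPart H s

lemma mem_exchange {x u : V} :
    u ∈ exchange H s E x ↔ u ∉ E ∧ insert u (E.erase x) ∈ typicalPart H s := by
  simp [exchange]

lemma typicalDeg_erase_le (hk : ∀ E ∈ H, E.card = k) (hE : E ∈ typicalPart H s) {x : V}
    (hx : x ∈ E) : typicalDeg H s (E.erase x) ≤ (exchange H s E x).card + 1 := by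
  have hsub : (typicalPart H s).filter (fun F => E.erase x ⊆ F) ⊆
      insert E ((exchange H s E x).image fun u => insert u (E.erase x)) := by
    intro F hF
    rw [mem_filter] at hF
    have hcard : F.card = (E.erase x).card + 1 := by
      rw [card_erase_add_one hx, hk E (typicalPart_subset H s hE),
        hk F (typicalPart_subset H s hF.1)]
    obtain ⟨y, hyF, hyT⟩ := exists_mem_notMem_of_card_lt_card
      (show (E.erase x).card < F.card by omega)
    have hFy := eq_insert_of_card hF.2 hcard hyF hyT
    rw [mem_insert]
    by_cases hyx : y = x
    · left; rw [hFy, hyx, insert_erase hx]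
    · right
      refine mem_image.2 ⟨y, mem_exchange.2 ⟨fun h => hyT (mem_erase.2 ⟨hyx, h⟩), ?_⟩, hFy.symm⟩
      rw [← hFy]; exact hF.1
  refine (card_le_card hsub).trans ((card_insert_le _ _).trans ?_)
  exact Nat.add_le_add_right card_image_le 1

/-- In a family without `(a, d)`-Δ-systems, exchange sets of free vertices violate Hall's
condition. -/
lemma exists_hall_violator (hk : ∀ E ∈ H, E.card = k) (hs : 2 * d * k + k ≤ s) (hpd : p ≤ d)
    (ha : ∀ i, 0 < a i) (hka : 1 ≤ k)
    (hfree : ¬ ∃ F : Finset (Finset V), F ⊆ H ∧ IsVecNatDeltaSystem a d F)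
    (hE : E ∈ typicalPart H s) {A : Fin p → Finset V} (hA : IsVecPartition a E A) {i₀ : Fin p}
    (hi₀ : (A i₀ ∩ freeVerts H s E).card ≠ 1) {W : Finset V}
    (hW : ∀ i x, A i ∩ freeVerts H s E = {x} → x ∈ W) :
    ∃ Y ⊆ W, (Y.biUnion (exchange H s E)).card < Y.card := by
  by_contra hno
  push Not at hno
  apply hfree
  have hHall : ∀ S : Finset W, S.card ≤ (S.biUnion fun x : W => exchange H s E x).card := by
    intro S
    have h1 := hno (S.map (Function.Embedding.subtype _)) (by
      intro x hx
      rw [mem_map] at hx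
      obtain ⟨y, _, rfl⟩ := hx
      exact y.2)
    rw [card_map] at h1
    refine h1.trans (le_of_eq ?_)
    congr 1
    ext u
    simp only [mem_biUnion, mem_map]
    constructor
    · rintro ⟨x, ⟨y, hy, rfl⟩, hu⟩
      exact ⟨y, hy, hu⟩
    · rintro ⟨y, hy, hu⟩
      exact ⟨y, ⟨y, hy, rfl⟩, hu⟩
  obtain ⟨f, hf, hfU⟩ := (Finset.all_card_le_biUnion_card_iff_exists_injective _).1 hHall
  set g : V → V := fun x => if h : x ∈ W then f ⟨x, h⟩ else x with hg
  have hgW : ∀ x (h : x ∈ W), g x = f ⟨x, h⟩ := fun x h => dif_pos h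
  have hEH := typicalPart_subset H s hE
  have hEt := (mem_typicalPart.1 hE).2
  -- Only parts with a lone free vertex need an exchange; they reserve its matched vertex. The value
  -- of `g` off `W` is never used.
  set P : Fin p → Finset V := fun i =>
    if (A i ∩ freeVerts H s E).card = 1 then (A i ∩ freeVerts H s E).image g else ∅ with hP
  refine exists_vecNatDeltaSystem hk hpd ha hEH hA P ?_ ?_ i₀ (by simp only [hP]; rw [if_neg hi₀]) ?_
  · intro i j hij
    simp only [hP]
    split_ifs with h1 h2
    · rw [card_eq_one] at h1 h2
      obtain ⟨x, hx⟩ := h1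
      obtain ⟨y, hy⟩ := h2
      have hxW := hW i x hx
      have hyW := hW j y hy
      have hxA : x ∈ A i := (mem_inter.1 (hx ▸ mem_singleton_self x :
        x ∈ A i ∩ freeVerts H s E)).1
      have hyA : y ∈ A j := (mem_inter.1 (hy ▸ mem_singleton_self y :
        y ∈ A j ∩ freeVerts H s E)).1
      rw [hx, hy, image_singleton, image_singleton, disjoint_singleton, hgW x hxW, hgW y hyW]
      intro h
      have := hf h
      rw [Subtype.mk.injEq] at this
      subst this
      exact disjoint_left.1 (hA.disjoint i j hij) hxA hyA
    · exact disjoint_empty_right _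
    · exact disjoint_empty_left _
    · exact disjoint_empty_left _
  · intro i
    simp only [hP]
    split_ifs with h1
    · exact card_image_le.trans (h1.le.trans hka)
    · simp
  · intro i Z hZ
    have hZ' : Z.card + k ≤ s := by omega
    simp only [hP]
    split_ifs with h1
    · rw [card_eq_one] at h1
      obtain ⟨x, hx⟩ := h1
      have hxW := hW i x hx
      have hxm := mem_inter.1 (hx ▸ mem_singleton_self x : x ∈ A i ∩ freeVerts H s E)
      have hu := mem_exchange.1 (hfU ⟨x, hxW⟩)
      rw [hx, image_singleton, hgW x hxW]
      exact IsTypical.exists_inter_eq_sdiff hk hEH hxm.2 hu.1 hu.2 hxm.1 (hA.subset i) hZ'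
    · obtain ⟨F, hF, h2, h3⟩ := (hEt.isKernel_sdiff hEH (hA.subset i) h1).exists_inter_eq hk hEH
        sdiff_subset hZ'
      exact ⟨F, hF, h2, h3.le⟩

/-- Each degree is at most one more than the size of the exchange set, hence at most `Y.card`; so
each of the `Y.card` terms is at least `1 / Y.card`. -/
lemma one_le_sum_of_hall_violator (hk : ∀ E ∈ H, E.card = k) (hE : E ∈ typicalPart H s)
    {Y : Finset V} (hYE : Y ⊆ E) (hY : (Y.biUnion (exchange H s E)).card < Y.card) :
    (1 : ℝ) ≤ ∑ x ∈ Y, 1 / (typicalDeg H s (E.erase x) : ℝ) := by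
  have hYpos : (0 : ℝ) < Y.card := by
    exact_mod_cast (Nat.zero_le _).trans_lt hY
  calc (1 : ℝ) = ∑ x ∈ Y, 1 / (Y.card : ℝ) := by
        rw [sum_const, nsmul_eq_mul, mul_one_div_cancel hYpos.ne']
    _ ≤ _ := by
        refine sum_le_sum fun x hx => ?_
        have h1 := typicalDeg_erase_le hk hE (hYE hx)
        have h2 : (exchange H s E x).card ≤ (Y.biUnion (exchange H s E)).card :=
          card_le_card (subset_biUnion_of_mem _ hx)
        have h3 := typicalDeg_erase_pos hE x
        apply one_div_le_one_div_of_le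
        · exact_mod_cast h3
        · exact_mod_cast (by omega : typicalDeg H s (E.erase x) ≤ Y.card)

/-- Every typical set has weight at least `1`. -/
lemma one_le_weight (hk : ∀ E ∈ H, E.card = k) (hs : 2 * d * k + k ≤ s) (hpd : p ≤ d)
    (ha : ∀ i, 0 < a i) (hka : ∑ i, a i = k) (hp : 2 ≤ p)
    (hfree : ¬ ∃ F : Finset (Finset V), F ⊆ H ∧ IsVecNatDeltaSystem a d F)
    (hE : E ∈ typicalPart H s) (hN : (freeVerts H s E).card ≤ 1) :
    (1 : ℝ) ≤ ∑ x ∈ freeVerts H s E, 1 / (typicalDeg H s (E.erase x) : ℝ) := by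
  have hEH := typicalPart_subset H s hE
  let j₀ : Fin p := ⟨0, by omega⟩
  let j₁ : Fin p := ⟨1, by omega⟩
  have hj : j₀ ≠ j₁ := by simp [j₀, j₁]
  have hk1 : 1 ≤ k := by
    rw [← hka]
    exact (ha j₀).trans_le (single_le_sum (fun i _ => Nat.zero_le _) (mem_univ j₀))
  obtain ⟨A, hA, -⟩ := exists_isVecPartition (t := ∅) j₀ ((hk E hEH).trans hka.symm)
    (empty_subset _) (by simp)
  -- At most one free vertex cannot give two disjoint parts one each.
  have hi₀ : ∃ i₀, (A i₀ ∩ freeVerts H s E).card ≠ 1 := by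
    by_contra hcon
    push Not at hcon
    have hdis : Disjoint (A j₀ ∩ freeVerts H s E) (A j₁ ∩ freeVerts H s E) :=
      disjoint_of_subset_left inter_subset_left
        (disjoint_of_subset_right inter_subset_left (hA.disjoint j₀ j₁ hj))
    have h1 := card_union_of_disjoint hdis
    have h2 : ((A j₀ ∩ freeVerts H s E) ∪ (A j₁ ∩ freeVerts H s E)).card ≤
        (freeVerts H s E).card :=
      card_le_card (union_subset inter_subset_right inter_subset_right)
    rw [hcon, hcon] at h1
    omega
  obtain ⟨i₀, hi₀⟩ := hi₀
  obtain ⟨Y, hYN, hY⟩ := exists_hall_violator hk hs hpd ha hk1 hfree hE hA hi₀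
    (W := freeVerts H s E) (fun i x hx =>
      (mem_inter.1 (hx ▸ mem_singleton_self x : x ∈ A i ∩ freeVerts H s E)).2)
  refine (one_le_sum_of_hall_violator hk hE (hYN.trans (freeVerts_subset H s E)) hY).trans ?_
  exact sum_le_sum_of_subset_of_nonneg hYN fun _ _ _ => by positivity

/-- A typical set with at least two free vertices has weight bounded away from `1`. -/
lemma one_add_le_weight (hk : ∀ E ∈ H, E.card = k) (hs : 2 * d * k + k ≤ s) (hpd : p ≤ d)
    (ha : ∀ i, 0 < a i) (hka : ∑ i, a i = k) (hpk : p < k)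
    (hfree : ¬ ∃ F : Finset (Finset V), F ⊆ H ∧ IsVecNatDeltaSystem a d F)
    (hE : E ∈ typicalPart H s) (hN : 1 < (freeVerts H s E).card) :
    1 + 1 / (s : ℝ) ≤ ∑ x ∈ freeVerts H s E, 1 / (typicalDeg H s (E.erase x) : ℝ) := by
  have hEH := typicalPart_subset H s hE
  obtain ⟨i₀, hi₀⟩ : ∃ i, 2 ≤ a i := by
    by_contra hcon
    push Not at hcon
    have : ∑ i, a i ≤ ∑ i : Fin p, 1 := sum_le_sum fun i _ => by have := hcon i; omega
    simp at this
    omega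
  rw [one_lt_card] at hN
  obtain ⟨x, hx, y, hy, hxy⟩ := hN
  have hsubN : ({x, y} : Finset V) ⊆ freeVerts H s E := by
    intro t ht
    rw [mem_insert, mem_singleton] at ht
    rcases ht with rfl | rfl <;> assumption
  obtain ⟨A, hA, hxyA⟩ := exists_isVecPartition (t := {x, y}) i₀ ((hk E hEH).trans hka.symm)
    (hsubN.trans (freeVerts_subset H s E)) (by rw [card_pair hxy]; exact hi₀)
  have hcard : 1 < (A i₀ ∩ freeVerts H s E).card := by
    have := card_le_card (subset_inter hxyA hsubN)
    rw [card_pair hxy] at this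
    omega
  -- Since `x` shares its part with `y`, it is never a lone free vertex. The violator can thus avoid
  -- `x`, whose own term of at least `1 / s` is a bonus.
  obtain ⟨Y, hYN, hY⟩ := exists_hall_violator hk hs hpd ha (by omega) hfree hE hA hcard.ne'
    (W := (freeVerts H s E).erase x) (by
      intro i z hz
      have hzm := mem_inter.1 (hz ▸ mem_singleton_self z : z ∈ A i ∩ freeVerts H s E)
      refine mem_erase.2 ⟨?_, hzm.2⟩
      rintro rfl
      have hii : i = i₀ := by
        by_contra hne
        exact disjoint_left.1 (hA.disjoint i i₀ hne) hzm.1 (hxyA (mem_insert_self _ _))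
      rw [hii] at hz
      rw [hz, card_singleton] at hcard
      exact lt_irrefl _ hcard)
  have h1 := one_le_sum_of_hall_violator hk hE
    (hYN.trans ((erase_subset _ _).trans (freeVerts_subset H s E))) hY
  have h2 : ∑ z ∈ Y, 1 / (typicalDeg H s (E.erase z) : ℝ) ≤
      ∑ z ∈ (freeVerts H s E).erase x, 1 / (typicalDeg H s (E.erase z) : ℝ) :=
    sum_le_sum_of_subset_of_nonneg hYN fun _ _ _ => by positivity
  have h3 : 1 / (s : ℝ) ≤ 1 / (typicalDeg H s (E.erase x) : ℝ) := by
    apply one_div_le_one_div_of_le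
    · exact_mod_cast typicalDeg_erase_pos hE x
    · exact_mod_cast typicalDeg_le_of_mem_freeVerts hk hE hx
  rw [← add_sum_erase _ _ hx]
  linarith

/-- The total weight of the typical sets is at most the number of `(k - 1)`-sets. -/
lemma sum_weight_le (hk : ∀ E ∈ H, E.card = k) :
    ∑ E ∈ typicalPart H s, ∑ x ∈ freeVerts H s E, 1 / (typicalDeg H s (E.erase x) : ℝ) ≤
      ((Fintype.card V).choose (k - 1) : ℝ) := by
  calc ∑ E ∈ typicalPart H s, ∑ x ∈ freeVerts H s E, 1 / (typicalDeg H s (E.erase x) : ℝ)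
      ≤ ∑ E ∈ typicalPart H s, ∑ T ∈ powersetCard (k - 1) (univ : Finset V),
          if T ⊆ E then 1 / (typicalDeg H s T : ℝ) else 0 := by
        refine sum_le_sum fun E hE => ?_
        rw [← sum_filter]
        have hinj : Set.InjOn (fun x => E.erase x) (freeVerts H s E) := by
          intro x hx y _ hxy
          exact (Finset.erase_inj _ (freeVerts_subset H s E hx)).1 hxy
        rw [← sum_image (f := fun T => 1 / (typicalDeg H s T : ℝ)) hinj]
        refine sum_le_sum_of_subset_of_nonneg ?_ fun _ _ _ => by positivity
        intro T hT
        rw [mem_image] at hT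
        obtain ⟨x, hx, rfl⟩ := hT
        rw [mem_filter, mem_powersetCard]
        refine ⟨⟨subset_univ _, ?_⟩, erase_subset _ _⟩
        rw [card_erase_of_mem (freeVerts_subset H s E hx), hk E (typicalPart_subset H s hE)]
    _ = ∑ T ∈ powersetCard (k - 1) (univ : Finset V), ∑ E ∈ typicalPart H s,
          if T ⊆ E then 1 / (typicalDeg H s T : ℝ) else 0 := sum_comm
    _ ≤ ∑ T ∈ powersetCard (k - 1) (univ : Finset V), 1 := by
        refine sum_le_sum fun T _ => ?_
        rw [← sum_filter, sum_const, nsmul_eq_mul, mul_one_div]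
        exact div_self_le_one _
    _ = _ := by
        rw [sum_const, card_powersetCard, card_univ, nsmul_eq_mul, mul_one]

/-- The typical sets with at most one free vertex. -/
noncomputable def monoPart (H : Finset (Finset V)) (s : ℕ) : Finset (Finset V) :=
  (typicalPart H s).filter fun E => (freeVerts H s E).card ≤ 1

/-- Compares the two lower bounds on weights with the upper bound on their total; this is what
limits the typical sets with several free vertices. -/
lemma card_typicalPart_add_le (hk : ∀ E ∈ H, E.card = k) (hs : 2 * d * k + k ≤ s) (hpd : p ≤ d)
    (ha : ∀ i, 0 < a i) (hka : ∑ i, a i = k) (hp : 2 ≤ p) (hpk : p < k)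
    (hfree : ¬ ∃ F : Finset (Finset V), F ⊆ H ∧ IsVecNatDeltaSystem a d F) :
    ((typicalPart H s).card : ℝ) + 1 / s * ((typicalPart H s).card - (monoPart H s).card) ≤
      ((Fintype.card V).choose (k - 1) : ℝ) := by
  refine le_trans ?_ (sum_weight_le (s := s) hk)
  have hpt : ∀ E ∈ typicalPart H s,
      (1 + if ¬ (freeVerts H s E).card ≤ 1 then 1 / (s : ℝ) else 0) ≤
        ∑ x ∈ freeVerts H s E, 1 / (typicalDeg H s (E.erase x) : ℝ) := by
    intro E hE
    split_ifs with h
    · rw [add_zero]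
      exact one_le_weight hk hs hpd ha hka hp hfree hE h
    · exact one_add_le_weight hk hs hpd ha hka hpk hfree hE (by omega)
  refine le_trans (le_of_eq ?_) (sum_le_sum hpt)
  rw [sum_add_distrib, sum_const, nsmul_eq_mul, mul_one, ← sum_filter, sum_const, nsmul_eq_mul]
  have h1 := card_filter_add_card_filter_not (s := typicalPart H s)
    (fun E => (freeVerts H s E).card ≤ 1)
  have h2 : (((monoPart H s).card + ((typicalPart H s).filter
    fun E => ¬ (freeVerts H s E).card ≤ 1).card : ℕ) : ℝ) = (typicalPart H s).card := by
    exact_mod_cast h1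
  push_cast at h2
  rw [← h2]
  ring

end Weight

/-! ### Sets with a unique free vertex, grouped by that vertex -/

section Apex

variable {V : Type*} [DecidableEq V] [Fintype V]
variable {H : Finset (Finset V)} {k s d p : ℕ} {a : Fin p → ℕ}

/-- Without free vertices the weight would be an empty sum, not at least `1`. -/
lemma exists_freeVerts_eq_singleton (hk : ∀ E ∈ H, E.card = k) (hs : 2 * d * k + k ≤ s)
    (hpd : p ≤ d) (ha : ∀ i, 0 < a i) (hka : ∑ i, a i = k) (hp : 2 ≤ p)
    (hfree : ¬ ∃ F : Finset (Finset V), F ⊆ H ∧ IsVecNatDeltaSystem a d F) {E : Finset V}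
    (hE : E ∈ monoPart H s) : ∃ v, freeVerts H s E = {v} := by
  rw [monoPart, mem_filter] at hE
  have h1 := one_le_weight hk hs hpd ha hka hp hfree hE.1 hE.2
  rw [← card_eq_one]
  rcases Nat.lt_or_ge (freeVerts H s E).card 1 with h | h
  · rw [Nat.lt_one_iff, card_eq_zero] at h
    rw [h, sum_empty] at h1
    norm_num at h1
  · exact le_antisymm hE.2 h

omit [Fintype V] in
/-- Two sets with a unique free vertex each that are close to each other have the same free
vertex. -/
lemma freeVert_eq_of_card_inter (hk : ∀ E ∈ H, E.card = k) (hs : 2 * d * k + 2 * k ≤ s)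
    (hpd : p ≤ d) (ha : ∀ i, 0 < a i) (hka : ∑ i, a i = k) (hp : 2 ≤ p) (hpk : p < k)
    (hfree : ¬ ∃ F : Finset (Finset V), F ⊆ H ∧ IsVecNatDeltaSystem a d F) {E E' : Finset V}
    {v v' : V} (hE : E ∈ typicalPart H s) (hE' : E' ∈ typicalPart H s)
    (hv : freeVerts H s E = {v}) (hv' : freeVerts H s E' = {v'})
    (hint : k - 2 ≤ (E.erase v ∩ E'.erase v').card) : v = v' := by
  by_contra hne
  have hEH := typicalPart_subset H s hE
  have hE'H := typicalPart_subset H s hE'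
  have hEt := (mem_typicalPart.1 hE).2
  have hE't := (mem_typicalPart.1 hE').2
  have hvE : v ∈ E := freeVerts_subset H s E (hv ▸ mem_singleton_self v)
  have hvE' : v' ∈ E' := freeVerts_subset H s E' (hv' ▸ mem_singleton_self v')
  obtain ⟨i₀, hi₀⟩ : ∃ i, 2 ≤ a i := by
    by_contra hcon
    push Not at hcon
    have : ∑ i, a i ≤ ∑ i : Fin p, 1 := sum_le_sum fun i _ => by have := hcon i; omega
    simp at this
    omega
  obtain ⟨j₀, hj₀⟩ : ∃ j : Fin p, j ≠ i₀ := by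
    have : Nontrivial (Fin p) := Fin.nontrivial_iff_two_le.2 hp
    exact exists_ne i₀
  have hlt : a i₀ < k := by
    have h1 : a i₀ + a j₀ ≤ ∑ i, a i := by
      rw [← sum_pair hj₀.symm]
      exact sum_le_sum_of_subset (subset_univ _)
    have := ha j₀
    omega
  -- The size is chosen so that `insert v' C` meets `E` in exactly `k - a i₀` vertices. It fits
  -- because `2 ≤ a i₀`, and `a i₀ < k` keeps the subtraction of `1` from truncating.
  obtain ⟨C, hC, hCcard⟩ := exists_subset_card_eq
    (show (if v' ∈ E then k - a i₀ - 1 else k - a i₀) ≤ (E.erase v ∩ E'.erase v').card by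
      split_ifs <;> omega)
  have hCE : ∀ t ∈ C, t ∈ E ∧ t ∈ E' ∧ t ≠ v ∧ t ≠ v' := by
    intro t ht
    have := hC ht
    simp only [mem_inter, mem_erase] at this
    tauto
  have hKE' : insert v' C ⊆ E' := insert_subset hvE' fun t ht => (hCE t ht).2.1
  have hK : IsKernel H s (insert v' C) := by
    have := hE't.isKernel_sdiff hE'H (A := E' \ insert v' C) sdiff_subset (by
      rw [hv']
      have : (E' \ insert v' C) ∩ {v'} = ∅ := by
        rw [inter_singleton_of_notMem]
        simp
      rw [this]; simp)
    rwa [Finset.sdiff_sdiff_eq_self hKE'] at this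
  -- `insert v' C` is a kernel because it keeps the only free vertex of `E'`. Avoiding `E` outside
  -- `E'` controls the trace of `F` on `E`, so `E \ F` can be the part of size `a i₀` containing
  -- `v`, the one part whose complement in `E` is not known to be a kernel.
  obtain ⟨F, hFH, hFE', hFE⟩ := hK.exists_inter_eq hk hE'H hKE' (Z := E)
    (by rw [hk E hEH]; omega)
  have hFEeq : F ∩ E = insert v' C ∩ E := by
    ext t
    have h1 := Finset.ext_iff.1 hFE' t
    have h2 := Finset.ext_iff.1 hFE t
    simp only [mem_inter, mem_sdiff, notMem_empty] at h1 h2 ⊢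
    tauto
  have hFcard : (F ∩ E).card = k - a i₀ := by
    rw [hFEeq]
    have hv'C : v' ∉ C := fun h => (hCE v' h).2.2.2 rfl
    have hCsub : C ⊆ E := fun t ht => (hCE t ht).1
    split_ifs at hCcard with h
    · rw [inter_eq_left.2 (insert_subset h hCsub), card_insert_of_notMem hv'C, hCcard]
      omega
    · rw [insert_inter_of_notMem h, inter_eq_left.2 hCsub, hCcard]
  have hvF : v ∉ F := by
    intro h
    have : v ∈ insert v' C ∩ E := hFEeq ▸ mem_inter.2 ⟨h, hvE⟩
    rw [mem_inter, mem_insert] at this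
    rcases this.1 with h | h
    · exact hne h
    · exact (hCE v h).2.2.1 rfl
  have hEF : (E \ F).card = a i₀ := by
    have := card_sdiff_add_card_inter E F
    rw [inter_comm, hFcard, hk E hEH] at this
    omega
  obtain ⟨A, hA, hsub⟩ := exists_isVecPartition i₀ ((hk E hEH).trans hka.symm)
    (sdiff_subset : E \ F ⊆ E) hEF.le
  have hA₀ : E \ F = A i₀ := eq_of_subset_of_card_le hsub (by rw [hA.card_eq, hEF])
  apply hfree
  -- The single petal `F` for `i₀` is fixed in advance, so all of `F \ E` is reserved; the other
  -- parts miss `v` and have kernels as centers.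
  refine exists_vecNatDeltaSystem hk hpd ha hEH hA (fun i => if i = i₀ then F \ E else ∅) ?_ ?_ j₀
    (if_neg hj₀) ?_
  · intro i j hij
    split_ifs with h1 h2
    · exact absurd (h1.trans h2.symm) hij
    all_goals simp
  · intro i
    split_ifs
    · exact (card_le_card sdiff_subset).trans (hk F hFH).le
    · simp
  · intro i Z hZ
    split_ifs with h
    · refine ⟨F, hFH, ?_, inter_subset_left⟩
      rw [h, ← hA₀, sdiff_sdiff_right_self, inf_eq_inter, inter_comm]
    · have hvA : v ∉ A i := fun hvi =>
        disjoint_left.1 (hA.disjoint i i₀ h) hvi (hA₀ ▸ mem_sdiff.2 ⟨hvE, hvF⟩)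
      obtain ⟨G, hG, h2, h3⟩ := (hEt.isKernel_sdiff hEH (hA.subset i) (by
        rw [hv, inter_singleton_of_notMem hvA]; simp)).exists_inter_eq hk hEH
        sdiff_subset (Z := Z) (by nlinarith)
      exact ⟨G, hG, h2, h3.le⟩

open Classical in
/-- The sets `E \ {v}`, over all sets `E` whose only free vertex is `v`. -/
noncomputable def baseFamily (H : Finset (Finset V)) (s : ℕ) (v : V) : Finset (Finset V) :=
  ((monoPart H s).filter fun E => freeVerts H s E = {v}).image fun E => E.erase v

omit [Fintype V] in
lemma mem_baseFamily {v : V} {T : Finset V} : T ∈ baseFamily H s v ↔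
    ∃ E ∈ typicalPart H s, freeVerts H s E = {v} ∧ E.erase v = T := by
  simp only [baseFamily, monoPart, mem_image, mem_filter]
  constructor
  · rintro ⟨E, ⟨⟨h1, -⟩, h2⟩, h3⟩
    exact ⟨E, h1, h2, h3⟩
  · rintro ⟨E, h1, h2, h3⟩
    exact ⟨E, ⟨⟨h1, by rw [h2]; simp⟩, h2⟩, h3⟩

omit [Fintype V] in
lemma sized_baseFamily (hk : ∀ E ∈ H, E.card = k) (v : V) :
    (baseFamily H s v : Set (Finset V)).Sized (k - 1) := by
  intro T hT
  rw [mem_coe, mem_baseFamily] at hT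
  obtain ⟨E, hE, hv, rfl⟩ := hT
  have hvE : v ∈ E := freeVerts_subset H s E (hv ▸ mem_singleton_self v)
  rw [card_erase_of_mem hvE, hk E (typicalPart_subset H s hE)]

omit [Fintype V] in
lemma card_baseFamily (v : V) : (baseFamily H s v).card =
    ((monoPart H s).filter fun E => freeVerts H s E = {v}).card := by
  classical
  rw [baseFamily]
  convert card_image_of_injOn ?_
  intro E hE E' hE' h
  simp only [coe_filter, Set.mem_ofPred_eq] at hE hE'
  have hvE : v ∈ E := freeVerts_subset H s E (hE.2 ▸ mem_singleton_self v)
  have hvE' : v ∈ E' := freeVerts_subset H s E' (hE'.2 ▸ mem_singleton_self v)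
  rw [← insert_erase hvE, ← insert_erase hvE']
  exact congrArg (insert v) h

lemma card_monoPart_le (hk : ∀ E ∈ H, E.card = k) (hs : 2 * d * k + k ≤ s)
    (hpd : p ≤ d) (ha : ∀ i, 0 < a i) (hka : ∑ i, a i = k) (hp : 2 ≤ p)
    (hfree : ¬ ∃ F : Finset (Finset V), F ⊆ H ∧ IsVecNatDeltaSystem a d F) :
    (monoPart H s).card ≤ ∑ v, (baseFamily H s v).card := by
  classical
  have hsub : monoPart H s ⊆ (univ : Finset V).biUnion fun v =>
      (monoPart H s).filter fun E => freeVerts H s E = {v} := by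
    intro E hE
    obtain ⟨v, hv⟩ := exists_freeVerts_eq_singleton hk hs hpd ha hka hp hfree hE
    exact mem_biUnion.2 ⟨v, mem_univ v, mem_filter.2 ⟨hE, hv⟩⟩
  refine (card_le_card hsub).trans (card_biUnion_le.trans (sum_le_sum fun v _ => ?_))
  rw [card_baseFamily]

/-- The shadows are disjoint: a common `(k-2)`-set lies in two bases, which by
`freeVert_eq_of_card_inter` belong to the same vertex. -/
lemma sum_card_shadow_baseFamily_le (hk : ∀ E ∈ H, E.card = k) (hs : 2 * d * k + 2 * k ≤ s)
    (hpd : p ≤ d) (ha : ∀ i, 0 < a i) (hka : ∑ i, a i = k) (hp : 2 ≤ p) (hpk : p < k)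
    (hfree : ¬ ∃ F : Finset (Finset V), F ⊆ H ∧ IsVecNatDeltaSystem a d F) :
    ∑ v, (∂ (baseFamily H s v)).card ≤ (Fintype.card V).choose (k - 2) := by
  rw [← card_biUnion]
  · rw [← card_univ, ← card_powersetCard]
    refine card_le_card fun S hS => ?_
    obtain ⟨v, -, hS⟩ := mem_biUnion.1 hS
    rw [mem_powersetCard]
    exact ⟨subset_univ _, (sized_baseFamily hk v).shadow hS⟩
  · intro v _ v' _ hne
    rw [Function.onFun, disjoint_left]
    intro S hS hS'
    have hScard : S.card = k - 1 - 1 := (sized_baseFamily hk v).shadow hS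
    rw [mem_shadow_iff] at hS hS'
    obtain ⟨T, hT, x, -, hx⟩ := hS
    obtain ⟨T', hT', x', -, hx'⟩ := hS'
    obtain ⟨E, hE, hv, rfl⟩ := mem_baseFamily.1 hT
    obtain ⟨E', hE', hv', rfl⟩ := mem_baseFamily.1 hT'
    refine hne (freeVert_eq_of_card_inter hk hs hpd ha hka hp hpk hfree hE hE' hv hv' ?_)
    have : S ⊆ E.erase v ∩ E'.erase v' :=
      subset_inter (hx ▸ erase_subset _ _) (hx' ▸ erase_subset _ _)
    have := card_le_card this
    omega

omit [Fintype V] in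
lemma card_baseFamily_le_filter (v : V) :
    (baseFamily H s v).card ≤ (H.filter fun E => v ∈ E).card := by
  rw [card_baseFamily]
  refine card_le_card fun E hE => ?_
  rw [mem_filter, monoPart, mem_filter] at hE
  exact mem_filter.2 ⟨typicalPart_subset H s hE.1.1,
    freeVerts_subset H s E (hE.2 ▸ mem_singleton_self v)⟩

end Apex

/-! ### Kruskal–Katona estimates -/

section Shadow

/-- A family whose size is less than `(y choose r)` has a comparatively large shadow. -/
lemma mul_card_le_mul_card_shadow {n r y : ℕ} (hr : 1 ≤ r) {𝒜 : Finset (Finset (Fin n))}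
    (h𝒜 : (𝒜 : Set (Finset (Fin n))).Sized r) (hy : 𝒜.card < y.choose r) (hyn : y ≤ n) :
    r * 𝒜.card ≤ y * (∂ 𝒜).card := by
  rcases Nat.eq_zero_or_pos 𝒜.card with h0 | hpos
  · rw [h0]; simp
  have hex : ∃ x : ℕ, 𝒜.card < x.choose r := ⟨y, hy⟩
  classical
  -- With `x` least, `z = x - 1` has `z.choose r ≤ 𝒜.card`, so the shadow has at least `z.choose (r
  -- - 1)` members, and `r * x.choose r = x * z.choose (r - 1)`.
  set x := Nat.find hex with hx
  have hxy : x ≤ y := Nat.find_min' hex hy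
  have hxs : 𝒜.card < x.choose r := Nat.find_spec hex
  have hx0 : x ≠ 0 := by
    intro h
    rw [h, Nat.choose_eq_zero_of_lt (by omega)] at hxs
    omega
  obtain ⟨z, hz⟩ := Nat.exists_eq_succ_of_ne_zero hx0
  have hzs : z.choose r ≤ 𝒜.card := by
    by_contra hcon
    have := Nat.find_min' hex (not_le.1 hcon)
    omega
  have hrx : r ≤ x := by
    by_contra hcon
    rw [Nat.choose_eq_zero_of_lt (not_le.1 hcon)] at hxs
    omega
  have hshadow : z.choose (r - 1) ≤ (∂ 𝒜).card := by
    -- The Lovász form is applied for `r ≤ z`; for `z = r - 1` only a nonempty shadow is needed.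
    rcases Nat.lt_or_ge z r with h | h
    · have hzr : z = r - 1 := by omega
      rw [hzr, Nat.choose_self]
      obtain ⟨T, hT⟩ := card_pos.1 hpos
      have hTc : T.card = r := h𝒜 hT
      obtain ⟨t, ht⟩ := card_pos.1 (show 0 < T.card by omega)
      exact card_pos.2 ⟨T.erase t, erase_mem_shadow hT ht⟩
    · exact kruskal_katona_lovasz_form (i := 1) hr h (by omega) h𝒜 hzs
  calc r * 𝒜.card ≤ r * (x.choose r) := Nat.mul_le_mul_left _ hxs.le
    _ = x * z.choose (r - 1) := by
        obtain ⟨q, rfl⟩ : ∃ q, r = q + 1 := ⟨r - 1, by omega⟩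
        rw [hz, Nat.add_sub_cancel, Nat.succ_eq_add_one, Nat.add_one_mul_choose_eq, mul_comm]
    _ ≤ y * (∂ 𝒜).card := Nat.mul_le_mul hxy hshadow

/-- If families of `r`-sets have shadows of bounded total size and are large together, one of them
is large. -/
lemma exists_choose_le_card {n r y : ℕ} {ι : Type*} [Fintype ι] (hr : 1 ≤ r) (hyn : y ≤ n)
    (𝒜 : ι → Finset (Finset (Fin n))) (h𝒜 : ∀ i, (𝒜 i : Set (Finset (Fin n))).Sized r)
    (hshadow : ∑ i, (∂ (𝒜 i)).card ≤ n.choose (r - 1))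
    (hlarge : y * n.choose (r - 1) < r * ∑ i, (𝒜 i).card) :
    ∃ i, y.choose r ≤ (𝒜 i).card := by
  by_contra hcon
  push Not at hcon
  have : r * ∑ i, (𝒜 i).card ≤ y * n.choose (r - 1) := by
    rw [mul_sum]
    refine (sum_le_sum fun i _ => mul_card_le_mul_card_shadow hr (h𝒜 i) (hcon i) hyn).trans ?_
    rw [← mul_sum]
    exact Nat.mul_le_mul_left _ hshadow
  omega

lemma choose_le_choose_add {n y r : ℕ} (hyn : y ≤ n) :
    n.choose (r + 1) ≤ y.choose (r + 1) + (n - y) * n ^ r := by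
  obtain ⟨m, rfl⟩ := Nat.exists_eq_add_of_le hyn
  rw [Nat.add_sub_cancel_left]
  suffices h : ∀ j ≤ m, (y + j).choose (r + 1) ≤ y.choose (r + 1) + j * (y + m) ^ r from h m le_rfl
  intro j
  induction j with
  | zero => simp
  | succ j ih =>
    intro hj
    have h1 := ih (by omega)
    have h2 : (y + j).choose r ≤ (y + m) ^ r :=
      (Nat.choose_le_pow _ _).trans (Nat.pow_le_pow_left (by omega) _)
    rw [← add_assoc, Nat.choose_succ_succ]
    nlinarith

end Shadow

/-! ### Numerical bounds and the main theorem -/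

/-- The numerical deduction that the part of `H` with a unique free vertex, of size `m`, is large:
`t` is the size of the typical part, `h` that of `H`, `C = n.choose (q + 1)` and `D = n.choose q`. -/
lemma mul_lt_mul_of_count_bounds {q s B η ε C C' D h t m n y : ℝ} (hq : 0 ≤ q) (hs : 0 < s)
    (hη : 0 ≤ η) (hε : 0 ≤ ε) (hε1 : ε ≤ 1) (hεs : (s + 1) * ε = η / 2) (hD : 0 < D)
    (hCD : (q + 1) * C = (n - q) * D) (hC' : C - D ≤ C') (hh : (1 - ε) * C' ≤ h)
    (ht : h ≤ t + B * D) (hweight : t + 1 / s * (t - m) ≤ C)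
    (hn : 2 * ((q + 1) + (q + 1) * (s + 1) * (B + 1)) < η * n) (hy : y ≤ (1 - η) * n) :
    y * D < (q + 1) * m := by
  have hmlow : t - s * (C - t) ≤ m := by
    have h1 : 1 / s * (t - m) ≤ C - t := by linarith
    rw [one_div, inv_mul_le_iff₀ hs] at h1
    linarith
  have htlow : C - t ≤ ε * C + (B + 1) * D := by
    have h1 : (1 - ε) * (C - D) ≤ (1 - ε) * C' := mul_le_mul_of_nonneg_left hC' (by linarith)
    have h2 : 0 ≤ ε * D := by positivity
    linarith
  -- The deficit of `m` is at most `s + 1` times that of `t`; `ε` was scaled to absorb this factor.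
  have hmC : C - (η / 2 * C + (s + 1) * (B + 1) * D) ≤ m := by
    have h1 : (s + 1) * (C - t) ≤ (s + 1) * (ε * C + (B + 1) * D) :=
      mul_le_mul_of_nonneg_left htlow (by positivity)
    have h2 : (s + 1) * (ε * C + (B + 1) * D) = η / 2 * C + (s + 1) * (B + 1) * D := by
      rw [← hεs]; ring
    linarith
  have h1 : (q + 1) * (C - (η / 2 * C + (s + 1) * (B + 1) * D)) ≤ (q + 1) * m :=
    mul_le_mul_of_nonneg_left hmC (by positivity)
  have h2 : (q + 1) * (C - (η / 2 * C + (s + 1) * (B + 1) * D)) =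
      ((1 - η / 2) * (n - q) - (q + 1) * (s + 1) * (B + 1)) * D := by
    linear_combination (1 - η / 2) * hCD
  refine lt_of_lt_of_le ?_ (h2 ▸ h1)
  apply mul_lt_mul_of_pos_right _ hD
  have h3 : 0 ≤ η / 2 * q := by positivity
  linarith

end DeltaSys

theorem theorem1p6 (k d : ℕ) (δ : ℝ) (hδ : 0 < δ) :
    ∃ ε : ℝ, 0 < ε ∧ ∃ n₀ : ℕ,
      ∀ (p : ℕ) (a : Fin p → ℕ), 2 ≤ p → p < k → p ≤ d →
        (∀ i, 0 < a i) → ∑ i, a i = k →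
        ∀ n : ℕ, n₀ ≤ n → ∀ H : Finset (Finset (Fin n)),
          (∀ E ∈ H, E.card = k) →
          (¬ ∃ F : Finset (Finset (Fin n)), F ⊆ H ∧ DeltaSys.IsVecNatDeltaSystem a d F) →
          (1 - ε) * ((n - 1).choose (k - 1) : ℝ) ≤ (H.card : ℝ) →
          ∃ v : Fin n,
            ((H.filter fun E => v ∉ E).card : ℝ) ≤ δ * (n : ℝ) ^ (k - 1) := by
  rcases Nat.lt_or_ge k 3 with hk3 | hk3
  · exact ⟨1, one_pos, 0, fun p a h2 hp => by omega⟩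
  obtain ⟨q, rfl⟩ : ∃ q, k = q + 2 := ⟨k - 2, by omega⟩
  -- Room to avoid all petals and reserved sets (`2dk`), plus two hosts as in
  -- `freeVert_eq_of_card_inter` (`2k`).
  obtain ⟨s, hs⟩ : ∃ s : ℕ, s = 2 * d * (q + 2) + 2 * (q + 2) := ⟨_, rfl⟩
  obtain ⟨B, hB⟩ : ∃ B : ℕ, B = 2 ^ q * s ^ 2 + s ^ 2 := ⟨_, rfl⟩
  -- Half of `δ` pays for replacing `n` by `(1 - η) * n`; the other half, through `n₂`, pays for
  -- rounding and the atypical sets.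
  obtain ⟨η, hη⟩ : ∃ η : ℝ, η = min δ 1 / 2 := ⟨_, rfl⟩
  have hmin : 0 < min δ 1 := lt_min hδ one_pos
  have hη0 : 0 < η := by rw [hη]; positivity
  have hηδ : η ≤ δ / 2 := by rw [hη]; linarith [min_le_left δ 1]
  have hη1 : η ≤ 1 / 2 := by rw [hη]; linarith [min_le_right δ 1]
  have hs0 : (0 : ℝ) < s := by
    have : 0 < s := by omega
    exact_mod_cast this
  obtain ⟨ε, hε⟩ : ∃ ε : ℝ, ε = η / (2 * (s + 1)) := ⟨_, rfl⟩
  have hε0 : 0 < ε := by rw [hε]; positivity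
  have hεs : (s + 1) * ε = η / 2 := by rw [hε]; field_simp
  have hε1 : ε ≤ 1 := by nlinarith
  obtain ⟨n₁, hn₁⟩ := exists_nat_gt (2 * ((q + 1) + (q + 1) * (s + 1) * (B + 1)) / η)
  obtain ⟨n₂, hn₂⟩ := exists_nat_gt (2 * (1 + B) / δ)
  refine ⟨ε, hε0, n₁ + n₂ + (q + 2), ?_⟩
  intro p a hp hpk hpd ha hka n hn H hk hfree hH
  have hnq : q + 2 ≤ n := by omega
  have hn₁' : 2 * ((q + 1) + (q + 1) * (s + 1) * (B + 1)) < η * n := by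
    have h1 : (n₁ : ℝ) ≤ n := by exact_mod_cast (by omega : n₁ ≤ n)
    have := hn₁.trans_le h1
    rw [div_lt_iff₀ hη0] at this
    linarith
  have hn₂' : 2 * (1 + (B : ℝ)) < δ * n := by
    have h1 : (n₂ : ℝ) ≤ n := by exact_mod_cast (by omega : n₂ ≤ n)
    have := hn₂.trans_le h1
    rw [div_lt_iff₀ hδ] at this
    linarith
  simp only [show q + 2 - 1 = q + 1 by omega] at hH ⊢
  obtain ⟨C, hC⟩ : ∃ C : ℝ, C = (n.choose (q + 1) : ℝ) := ⟨_, rfl⟩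
  obtain ⟨D, hD⟩ : ∃ D : ℝ, D = (n.choose q : ℝ) := ⟨_, rfl⟩
  have hD0 : 0 < D := by
    have : 0 < n.choose q := Nat.choose_pos (by omega)
    rw [hD]; exact_mod_cast this
  have hCD : (q + 1) * C = (n - q) * D := by
    have h1 := Nat.choose_succ_right_eq n q
    have h2 : ((n.choose (q + 1) * (q + 1) : ℕ) : ℝ) = ((n.choose q * (n - q) : ℕ) : ℝ) := by
      rw [h1]
    push_cast [Nat.cast_sub (show q ≤ n by omega)] at h2
    rw [hC, hD]; linarith
  have hpascal : C - D ≤ ((n - 1).choose (q + 1) : ℝ) := by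
    obtain ⟨m, rfl⟩ : ∃ m, n = m + 1 := ⟨n - 1, by omega⟩
    have h1 : (m + 1).choose (q + 1) ≤ m.choose (q + 1) + (m + 1).choose q := by
      rw [Nat.choose_succ_succ, add_comm]
      exact Nat.add_le_add_left (Nat.choose_le_choose _ (by omega)) _
    have h2 : (((m + 1).choose (q + 1) : ℕ) : ℝ) ≤
        ((m.choose (q + 1) + (m + 1).choose q : ℕ) : ℝ) := by exact_mod_cast h1
    push_cast at h2
    rw [Nat.add_sub_cancel, hC, hD]
    linarith
  have hs' : 2 * d * (q + 2) + (q + 2) ≤ s := by omega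
  have hatyp : (H.card : ℝ) ≤ (DeltaSys.typicalPart H s).card + B * D := by
    have h1 := DeltaSys.card_filter_not_isTypical_le s hk
    rw [card_sdiff_of_subset (DeltaSys.typicalPart_subset H s), Fintype.card_fin,
      Nat.add_sub_cancel, ← hB, mul_comm _ B] at h1
    have h2 : H.card ≤ (DeltaSys.typicalPart H s).card + B * n.choose q := by
      omega
    rw [hD]; exact_mod_cast h2
  have hweight := DeltaSys.card_typicalPart_add_le hk hs' hpd ha hka hp hpk hfree
  rw [Fintype.card_fin, show q + 2 - 1 = q + 1 by omega] at hweight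
  obtain ⟨y, hy⟩ : ∃ y : ℕ, y = ⌊(1 - η) * n⌋₊ := ⟨_, rfl⟩
  have hny : (0 : ℝ) ≤ (1 - η) * n := mul_nonneg (by linarith) (Nat.cast_nonneg n)
  have hy1 : (y : ℝ) ≤ (1 - η) * n := hy ▸ Nat.floor_le hny
  have hy2 : (1 - η) * n < y + 1 := hy ▸ Nat.lt_floor_add_one _
  have hyn : y ≤ n := by
    have : (y : ℝ) ≤ n := by nlinarith [(Nat.cast_nonneg n : (0 : ℝ) ≤ n)]
    exact_mod_cast this
  have hlarge : y * D < (q + 1) * ((DeltaSys.monoPart H s).card : ℝ) :=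
    DeltaSys.mul_lt_mul_of_count_bounds (Nat.cast_nonneg q) hs0 hη0.le hε0.le hε1 hεs hD0 hCD
      hpascal hH hatyp (hC ▸ hweight) hn₁' hy1
  obtain ⟨v, hv⟩ := DeltaSys.exists_choose_le_card (r := q + 1) (by omega) hyn
    (DeltaSys.baseFamily H s) (fun v => DeltaSys.sized_baseFamily hk v) (by
      have := DeltaSys.sum_card_shadow_baseFamily_le hk hs.ge hpd ha hka hp hpk hfree
      rwa [Fintype.card_fin, Nat.add_sub_cancel] at this) (by
      have h1 := DeltaSys.card_monoPart_le hk hs' hpd ha hka hp hfree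
      have h2 : y * n.choose q < (q + 1) * (DeltaSys.monoPart H s).card := by
        rw [hD] at hlarge; exact_mod_cast hlarge
      rw [Nat.add_sub_cancel]
      exact h2.trans_le (Nat.mul_le_mul_left _ h1))
  refine ⟨v, ?_⟩
  -- The weight count also bounds `H` from above, so the members through `v` leave little over.
  have htC : ((DeltaSys.typicalPart H s).card : ℝ) ≤ C := by
    have hle : ((DeltaSys.monoPart H s).card : ℝ) ≤ (DeltaSys.typicalPart H s).card := by
      exact_mod_cast card_le_card (filter_subset _ _)
    have : 0 ≤ 1 / (s : ℝ) *
        ((DeltaSys.typicalPart H s).card - (DeltaSys.monoPart H s).card : ℝ) :=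
      mul_nonneg (by positivity) (sub_nonneg.2 hle)
    linarith
  have h1 : (y.choose (q + 1) : ℝ) ≤ ((H.filter fun E => v ∈ E).card : ℝ) := by
    exact_mod_cast hv.trans (DeltaSys.card_baseFamily_le_filter v)
  have h2 : ((H.filter fun E => v ∈ E).card : ℝ) + ((H.filter fun E => v ∉ E).card : ℝ) =
      H.card := by
    exact_mod_cast card_filter_add_card_filter_not (s := H) (fun E => v ∈ E)
  have h3 : C ≤ y.choose (q + 1) + (n - y) * (n : ℝ) ^ q := by
    have h := DeltaSys.choose_le_choose_add (r := q) hyn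
    have h' : ((n.choose (q + 1) : ℕ) : ℝ) ≤
        ((y.choose (q + 1) + (n - y) * n ^ q : ℕ) : ℝ) := by exact_mod_cast h
    push_cast [Nat.cast_sub hyn] at h'
    rw [hC]; exact h'
  have h4 : D ≤ (n : ℝ) ^ q := by rw [hD]; exact_mod_cast Nat.choose_le_pow n q
  have h5 : (B : ℝ) * D ≤ B * (n : ℝ) ^ q := mul_le_mul_of_nonneg_left h4 (Nat.cast_nonneg B)
  have h6 : ((n - y) + (B : ℝ)) * (n : ℝ) ^ q ≤ (δ * n) * (n : ℝ) ^ q := by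
    apply mul_le_mul_of_nonneg_right _ (by positivity)
    have : η * n ≤ δ / 2 * n := mul_le_mul_of_nonneg_right hηδ (Nat.cast_nonneg n)
    linarith
  calc ((H.filter fun E => v ∉ E).card : ℝ) ≤ ((n - y) + (B : ℝ)) * (n : ℝ) ^ q := by
        linarith
    _ ≤ (δ * n) * (n : ℝ) ^ q := h6
    _ = δ * (n : ℝ) ^ (q + 1) := by ring
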